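/- For $c>0$ write $f_c(y)=c\,e^{-cy}\mathbf 1(y>0)$, $y\in\mathbb R$. Let $k>0$ with $k\neq 1$, let $\pi$ be the probability measure on $\mathbb R$ with Lebesgue density $f_1$ (also denoted $\pi(\cdot)$), let the proposal density be $q(x,y)=f_1(y)$ (an independence sampler whose proposal is the target), and let $\hat\pi=f_k$ be a surrogate for $\pi$. Set $$\alpha_{MH}(x,y)=1\wedge\frac{\pi(y)q(y,x)}{\pi(x)q(x,y)},\qquad \alpha_{DA}(x,y)=\Big[1\wedge\frac{\hat\pi(y)q(y,x)}{\hat\pi(x)q(x,y)}\Big]\Big[1\wedge\frac{\pi(y)/\hat\pi(y)}{\pi(x)/\hat\pi(x)}\Big],$$ where $1\wedge(\cdot)$ is taken to be $1$ when the denominator of the ratio is $0$ (and $0/0=0$ in the quotients $\pi/\hat\pi$; these conventions matter only on a $\pi$-null set of states). For $\ast\in\{MH,DA\}$ let $$P_\ast(x,dy)=q(x,y)\alpha_\ast(x,y)\,dy+\Big[1-\int q(x,z)\alpha_\ast(x,z)\,dz\Big]\delta_x(dy)$$ be the Metropolis-Hastings (MH) kernel and the delayed-acceptance (DA) kernel.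 For a Markov kernel $P$ that is reversible with respect to $\pi$: * $P$ is geometrically ergodic if there are $\rho<1$ and a finite function $C$ such that, for $\pi$-almost every $x$, $\sup_A|P^n(x,A)-\pi(A)|\le C(x)\rho^n$ for all $n$; * the conductance of $P$ is $\inf\big\{\frac1{\pi(A)}\int_A P(x,A^c)\,\pi(dx): A \text{ measurable},\ 0<\pi(A)\le \tfrac12\big\}$; * $P$ is variance bounding if for every $h\in L^2(\pi)$ the asymptotic variance $\lim_{n\to\infty} n\,\mathrm{Var}\big[\frac1n\sum_{i=1}^n h(X_i)\big]$ is finite, where $(X_i)_{i\ge1}$ is the Markov chain with kernel $P$ and $X_1\sim\pi$. Then $P_{MH}$ and $P_{DA}$ are reversible with respect to $\pi$; $P_{MH}$ is geometrically ergodic; $P_{DA}$ has conductance $0$; and $P_{DA}$ is neither geometrically ergodic nor variance bounding. -/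

import Mathlib

open MeasureTheory ProbabilityTheory Filter
open scoped ENNReal NNReal

namespace DelayedAcceptance

/-- A probability density with respect to the reference measure `lam`. -/
structure ProbDensity {X : Type*} [MeasurableSpace X] (lam : Measure X) where
  dens : X → ℝ
  measurable : Measurable dens
  nonneg : ∀ x, 0 ≤ dens x
  lintegral_eq_one : ∫⁻ x, ENNReal.ofReal (dens x) ∂lam = 1

/-- A proposal density `q(x, y)`: jointly measurable, and a probability density in `y`
for every current value `x`. -/
structure ProposalDensity {X : Type*} [MeasurableSpace X] (lam : Measure X) where
  dens : X → X → ℝ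
  measurable : Measurable (Function.uncurry dens)
  nonneg : ∀ x y, 0 ≤ dens x y
  lintegral_eq_one : ∀ x, ∫⁻ y, ENNReal.ofReal (dens x y) ∂lam = 1

/-- The probability measure with a given density. -/
noncomputable def ProbDensity.measure {X : Type*} [MeasurableSpace X] {lam : Measure X}
    (p : ProbDensity lam) : Measure X :=
  lam.withDensity fun x => ENNReal.ofReal (p.dens x)

instance ProbDensity.instIsProbabilityMeasure {X : Type*} [MeasurableSpace X] {lam : Measure X}
    (p : ProbDensity lam) : IsProbabilityMeasure p.measure :=
  ⟨by
    rw [ProbDensity.measure, withDensity_apply _ MeasurableSet.univ, Measure.restrict_univ]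
    exact p.lintegral_eq_one⟩

/-- The independence-sampler proposal `q(x, y) = q(y)`. -/
def independenceProposal {X : Type*} [MeasurableSpace X] {lam : Measure X}
    (p : ProbDensity lam) : ProposalDensity lam where
  dens := fun _ y => p.dens y
  measurable := p.measurable.comp measurable_snd
  nonneg := fun _ y => p.nonneg y
  lintegral_eq_one := fun _ => p.lintegral_eq_one

/-- A measurable acceptance probability `α(x, y) ∈ [0, 1]`. -/
structure AcceptanceProb (X : Type*) [MeasurableSpace X] where
  prob : X → X → ℝ
  measurable : Measurable (Function.uncurry prob)
  nonneg : ∀ x y, 0 ≤ prob x y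
  le_one : ∀ x y, prob x y ≤ 1

/-- The sub-stochastic density `y ↦ q(x, y) α(x, y)` of an accepted move from `x`. -/
noncomputable def acceptedDensity {X : Type*} [MeasurableSpace X] {lam : Measure X}
    (q : ProposalDensity lam) (a : AcceptanceProb X) (x y : X) : ℝ≥0∞ :=
  ENNReal.ofReal (q.dens x y * a.prob x y)

theorem measurable_acceptedDensity {X : Type*} [MeasurableSpace X] {lam : Measure X}
    (q : ProposalDensity lam) (a : AcceptanceProb X) :
    Measurable (Function.uncurry (acceptedDensity q a)) :=
  (q.measurable.mul a.measurable).ennreal_ofReal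

theorem lintegral_acceptedDensity_le_one {X : Type*} [MeasurableSpace X] {lam : Measure X}
    (q : ProposalDensity lam) (a : AcceptanceProb X) (x : X) :
    ∫⁻ y, acceptedDensity q a x y ∂lam ≤ 1 := by
  rw [← q.lintegral_eq_one x]
  exact lintegral_mono fun y =>
    ENNReal.ofReal_le_ofReal (mul_le_of_le_one_right (q.nonneg x y) (a.le_one x y))

/-- The propose-accept-reject kernel
`P(x, dy) = q(x, y) α(x, y) dy + [1 - ∫ q(x, z) α(x, z) dz] δ_x(dy)`. -/
noncomputable def parKernel {X : Type*} [MeasurableSpace X] {lam : Measure X} [SFinite lam]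
    (q : ProposalDensity lam) (a : AcceptanceProb X) : Kernel X X where
  toFun := fun x => lam.withDensity (acceptedDensity q a x) +
    (1 - ∫⁻ y, acceptedDensity q a x y ∂lam) • Measure.dirac x
  measurable' := by
    have h := measurable_acceptedDensity q a
    refine Measure.measurable_of_measurable_coe _ fun s hs => ?_
    simp only [Measure.add_apply, Measure.smul_apply, smul_eq_mul, withDensity_apply _ hs,
      Measure.dirac_apply' _ hs]
    exact (h.lintegral_prod_right' (ν := lam.restrict s)).add
      ((measurable_const.sub (h.lintegral_prod_right' (ν := lam))).mul
        (measurable_one.indicator hs))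

instance parKernel.instIsMarkovKernel {X : Type*} [MeasurableSpace X] {lam : Measure X}
    [SFinite lam] (q : ProposalDensity lam) (a : AcceptanceProb X) :
    IsMarkovKernel (parKernel q a) :=
  ⟨fun x => ⟨by
    change (lam.withDensity (acceptedDensity q a x) +
      (1 - ∫⁻ y, acceptedDensity q a x y ∂lam) • Measure.dirac x) Set.univ = 1
    rw [Measure.add_apply, withDensity_apply _ MeasurableSet.univ, Measure.restrict_univ,
      Measure.smul_apply, measure_univ, smul_eq_mul, mul_one]
    exact add_tsub_cancel_of_le (lintegral_acceptedDensity_le_one q a x)⟩⟩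

/-- `1 ∧ (num / den)`, with the usual Metropolis-Hastings convention that it is `1` when
`den = 0`. -/
noncomputable def acceptRatio (num den : ℝ) : ℝ :=
  if den = 0 then 1 else min 1 (num / den)

theorem acceptRatio_le_one (num den : ℝ) : acceptRatio num den ≤ 1 := by
  unfold acceptRatio
  split_ifs
  · exact le_rfl
  · exact min_le_left _ _

theorem acceptRatio_nonneg {num den : ℝ} (hn : 0 ≤ num) (hd : 0 ≤ den) :
    0 ≤ acceptRatio num den := by
  unfold acceptRatio
  split_ifs
  · exact zero_le_one
  · exact le_min zero_le_one (div_nonneg hn hd)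

theorem measurable_acceptRatio {Y : Type*} [MeasurableSpace Y] {f g : Y → ℝ}
    (hf : Measurable f) (hg : Measurable g) : Measurable fun y => acceptRatio (f y) (g y) :=
  Measurable.ite (hg (measurableSet_singleton 0)) measurable_const
    (measurable_const.min (hf.div hg))

/-- The Metropolis-Hastings acceptance probability
`1 ∧ π(y) q(y, x) / (π(x) q(x, y))`. -/
noncomputable def mhAcceptance {X : Type*} [MeasurableSpace X] {lam : Measure X}
    (p : ProbDensity lam) (q : ProposalDensity lam) : AcceptanceProb X where
  prob := fun x y => acceptRatio (p.dens y * q.dens y x) (p.dens x * q.dens x y)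
  measurable := measurable_acceptRatio
    ((p.measurable.comp measurable_snd).mul (q.measurable.comp measurable_swap))
    ((p.measurable.comp measurable_fst).mul q.measurable)
  nonneg := fun x y => acceptRatio_nonneg (mul_nonneg (p.nonneg y) (q.nonneg y x))
    (mul_nonneg (p.nonneg x) (q.nonneg x y))
  le_one := fun _ _ => acceptRatio_le_one _ _

/-- The delayed-acceptance acceptance probability, for the target `p` and the surrogate `s`:
`[1 ∧ s(y) q(y, x) / (s(x) q(x, y))] [1 ∧ (p(y) / s(y)) / (p(x) / s(x))]`. -/
noncomputable def daAcceptance {X : Type*} [MeasurableSpace X] {lam : Measure X}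
    (p s : ProbDensity lam) (q : ProposalDensity lam) : AcceptanceProb X where
  prob := fun x y => acceptRatio (s.dens y * q.dens y x) (s.dens x * q.dens x y) *
    acceptRatio (p.dens y / s.dens y) (p.dens x / s.dens x)
  measurable := (mhAcceptance s q).measurable.mul (measurable_acceptRatio
    ((p.measurable.comp measurable_snd).div (s.measurable.comp measurable_snd))
    ((p.measurable.comp measurable_fst).div (s.measurable.comp measurable_fst)))
  nonneg := fun x y => mul_nonneg ((mhAcceptance s q).nonneg x y)
    (acceptRatio_nonneg (div_nonneg (p.nonneg y) (s.nonneg y))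
      (div_nonneg (p.nonneg x) (s.nonneg x)))
  le_one := fun x y => mul_le_one₀ ((mhAcceptance s q).le_one x y)
    (acceptRatio_nonneg (div_nonneg (p.nonneg y) (s.nonneg y))
      (div_nonneg (p.nonneg x) (s.nonneg x))) (acceptRatio_le_one _ _)

/-- The Metropolis-Hastings kernel with target `p` and proposal `q`. -/
noncomputable def mhKernel {X : Type*} [MeasurableSpace X] {lam : Measure X} [SFinite lam]
    (p : ProbDensity lam) (q : ProposalDensity lam) : Kernel X X :=
  parKernel q (mhAcceptance p q)

/-- The delayed-acceptance kernel with target `p`, surrogate `s` and proposal `q`. -/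
noncomputable def daKernel {X : Type*} [MeasurableSpace X] {lam : Measure X} [SFinite lam]
    (p s : ProbDensity lam) (q : ProposalDensity lam) : Kernel X X :=
  parKernel q (daAcceptance p s q)

instance mhKernel.instIsMarkovKernel {X : Type*} [MeasurableSpace X] {lam : Measure X}
    [SFinite lam] (p : ProbDensity lam) (q : ProposalDensity lam) :
    IsMarkovKernel (mhKernel p q) :=
  parKernel.instIsMarkovKernel _ _

instance daKernel.instIsMarkovKernel {X : Type*} [MeasurableSpace X] {lam : Measure X}
    [SFinite lam] (p s : ProbDensity lam) (q : ProposalDensity lam) :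
    IsMarkovKernel (daKernel p s q) :=
  parKernel.instIsMarkovKernel _ _

/-- Total variation distance `sup_A |μ(A) - ν(A)|` of two probability measures. -/
noncomputable def tvDist {X : Type*} [MeasurableSpace X] (μ ν : Measure X) : ℝ≥0∞ :=
  ⨆ (A : Set X) (_ : MeasurableSet A), ENNReal.ofReal |μ.real A - ν.real A|

/-- Geometric ergodicity: there are `ρ < 1` and a finite function `C` such that
`‖Pⁿ(x, ·) - π‖_TV ≤ C(x) ρⁿ` for all `n`, for `π`-almost every `x`. -/
def GeometricallyErgodic {X : Type*} [MeasurableSpace X] (P : Kernel X X) (π : Measure X) :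
    Prop :=
  ∃ ρ : ℝ≥0, ρ < 1 ∧ ∃ C : X → ℝ≥0,
    ∀ᵐ x ∂π, ∀ n : ℕ, tvDist ((P ^ n) x) π ≤ (C x : ℝ≥0∞) * (ρ : ℝ≥0∞) ^ n

/-- The probability `κ(A)` that the stationary chain leaves `A` at the next step, given that
it currently is in `A`. -/
noncomputable def escapeProb {X : Type*} [MeasurableSpace X] (P : Kernel X X) (π : Measure X)
    (A : Set X) : ℝ≥0∞ :=
  (∫⁻ x in A, P x Aᶜ ∂π) / π A

/-- The conductance `inf {κ(A) : 0 < π(A) ≤ 1/2}`. -/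
noncomputable def conductance {X : Type*} [MeasurableSpace X] (P : Kernel X X)
    (π : Measure X) : ℝ≥0∞ :=
  ⨅ (A : Set X) (_ : MeasurableSet A) (_ : 0 < π A) (_ : π A ≤ 1 / 2), escapeProb P π A

/-- The law on path space of the Markov chain with initial law `π` and transition
kernel `P`. -/
noncomputable def chainLaw {X : Type*} [MeasurableSpace X] (P : Kernel X X) [IsMarkovKernel P]
    (π : Measure X) : Measure (ℕ → X) :=
  Kernel.trajMeasure (X := fun _ => X) π
    fun n => P.comap (fun x : (i : Finset.Iic n) → X => x ⟨n, Finset.mem_Iic.2 le_rfl⟩)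
      (measurable_pi_apply _)

/-- The asymptotic variance `lim n Var[(1/n) ∑_{i < n} h(X_i)]`, with values in `[0, ∞]`, of
the chain started from `π`. It is written as an upper limit, so that it is the limit whenever
the limit exists, as it always does for a reversible chain and `h ∈ L²(π)`. -/
noncomputable def asymptoticVariance {X : Type*} [MeasurableSpace X] (P : Kernel X X)
    [IsMarkovKernel P] (π : Measure X) (h : X → ℝ) : ℝ≥0∞ :=
  limsup (fun n : ℕ => (n : ℝ≥0∞) *
    evariance (fun ω : ℕ → X => (n : ℝ)⁻¹ * ∑ i ∈ Finset.range n, h (ω i)) (chainLaw P π)) atTop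

/-- Variance bounding: every square-integrable functional has finite asymptotic variance. -/
def VarianceBounding {X : Type*} [MeasurableSpace X] (P : Kernel X X) [IsMarkovKernel P]
    (π : Measure X) : Prop :=
  ∀ h : X → ℝ, MemLp h 2 π → asymptoticVariance P π h < ⊤

/-- The exponential density `k e^{-ky} 1(y > 0)` on the real line. -/
noncomputable def expDensity (k : ℝ) (hk : 0 < k) : ProbDensity (volume : Measure ℝ) where
  dens := fun y => if 0 < y then k * Real.exp (-(k * y)) else 0
  measurable := Measurable.ite measurableSet_Ioi (by fun_prop) measurable_const
  nonneg := fun y => by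
    split_ifs
    · positivity
    · exact le_rfl
  lintegral_eq_one := by
    rw [← lintegral_exponentialPDF_eq_one hk]
    refine lintegral_congr_ae ?_
    filter_upwards [Measure.ae_ne volume (0 : ℝ)] with y hy
    rw [exponentialPDF_eq]
    rcases lt_or_gt_of_ne hy with h | h
    · simp [h.not_gt, h.not_ge]
    · simp [h, h.le]

/-- The law with density `e^{-y} 1(y > 0)`. -/
noncomputable abbrev expLaw : Measure ℝ := (expDensity 1 one_pos).measure

/-- The Metropolis-Hastings independence sampler with target and proposal `e^{-y} 1(y > 0)`. -/
noncomputable abbrev expMH : Kernel ℝ ℝ :=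
  mhKernel (expDensity 1 one_pos) (independenceProposal (expDensity 1 one_pos))

/-- The corresponding delayed-acceptance kernel with surrogate `k e^{-ky} 1(y > 0)`. -/
noncomputable abbrev expDA (k : ℝ) (hk : 0 < k) : Kernel ℝ ℝ :=
  daKernel (expDensity 1 one_pos) (expDensity k hk)
    (independenceProposal (expDensity 1 one_pos))

end DelayedAcceptance

/-!
A Metropolis-Hastings independence sampler whose proposal is the target accepts every move, so its
kernel is constantly `π`. The two delayed-acceptance ratios at `(x, y)` are `r` and `r⁻¹` with
`r = exp ((1 - k) (y - x))`, so a move from `x` to `y` is accepted with probability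
`exp (-|1 - k| |y - x|)`, and the chain leaves `x` with a probability decaying exponentially in `x`.

All three failures come from this. The half-lines `(t, ∞)` have escape probability tending to `0`.
Geometric ergodicity with rate `ρ` would bound the holding probability `P(x, {x})` by `ρ`, because
`P(x, {x})ⁿ ≤ Pⁿ(x, {x})` while `π {x} = 0`. Finally, for `n` of order `exp (β t)`, a chain started
above `t` is likely to be held there up to time `n`, and then the empirical mean of `h` is the
initial value of `h`; so `n` times the variance of the mean is at least of order
`n ∫_{x > t} (h x - π h)² π(dx)`, which diverges for `h x = exp (γ x)` with `γ` slightly below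
`1/2`.
-/

namespace DelayedAcceptance

section Reversibility

theorem mul_acceptRatio {num den : ℝ} (hn : 0 ≤ num) (hd : 0 ≤ den) :
    den * acceptRatio num den = min den num := by
  rcases eq_or_ne den 0 with rfl | h
  · rw [zero_mul, min_eq_left hn]
  · rw [acceptRatio, if_neg h, mul_min_of_nonneg _ _ hd, mul_one, mul_div_cancel₀ _ h]

variable {X : Type*} [MeasurableSpace X] {lam : Measure X}

theorem ProbDensity.setLIntegral_measure (p : ProbDensity lam) (f : X → ℝ≥0∞) {s : Set X}
    (hs : MeasurableSet s) :
    ∫⁻ x in s, f x ∂p.measure = ∫⁻ x in s, ENNReal.ofReal (p.dens x) * f x ∂lam :=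
  setLIntegral_withDensity_eq_setLIntegral_mul_non_measurable _ p.measurable.ennreal_ofReal f
    hs (ae_of_all _ fun _ => ENNReal.ofReal_lt_top)

theorem ProbDensity.lintegral_measure (p : ProbDensity lam) (f : X → ℝ≥0∞) :
    ∫⁻ x, f x ∂p.measure = ∫⁻ x, ENNReal.ofReal (p.dens x) * f x ∂lam := by
  simpa only [Measure.restrict_univ] using p.setLIntegral_measure f MeasurableSet.univ

variable [SFinite lam]

theorem parKernel_apply (q : ProposalDensity lam) (a : AcceptanceProb X) (x : X) {s : Set X}
    (hs : MeasurableSet s) :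
    parKernel q a x s = ∫⁻ y in s, acceptedDensity q a x y ∂lam +
      (1 - ∫⁻ y, acceptedDensity q a x y ∂lam) * s.indicator 1 x := by
  change (lam.withDensity (acceptedDensity q a x) +
      (1 - ∫⁻ y, acceptedDensity q a x y ∂lam) • Measure.dirac x) s = _
  rw [Measure.add_apply, Measure.smul_apply, smul_eq_mul, withDensity_apply _ hs,
    Measure.dirac_apply' _ hs]

theorem setLIntegral_parKernel_apply (p : ProbDensity lam) (q : ProposalDensity lam)
    (a : AcceptanceProb X) {A B : Set X} (hA : MeasurableSet A) (hB : MeasurableSet B) :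
    ∫⁻ x in A, parKernel q a x B ∂p.measure =
      (∫⁻ x in A, ∫⁻ y in B, ENNReal.ofReal (p.dens x * (q.dens x y * a.prob x y)) ∂lam ∂lam) +
        ∫⁻ x in A ∩ B, (1 - ∫⁻ y, acceptedDensity q a x y ∂lam) ∂p.measure := by
  have hq := measurable_acceptedDensity q a
  have hmove : Measurable fun x => ∫⁻ y in B, acceptedDensity q a x y ∂lam :=
    hq.lintegral_prod_right' (ν := lam.restrict B)
  simp_rw [parKernel_apply q a _ hB]
  rw [lintegral_add_left hmove]
  congr 1
  · rw [p.setLIntegral_measure _ hA]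
    refine lintegral_congr fun x => ?_
    rw [← lintegral_const_mul _ (hq.of_uncurry_left (x := x))]
    simp_rw [ENNReal.ofReal_mul (p.nonneg x)]
    rfl
  · rw [Set.inter_comm, ← setLIntegral_indicator hB]
    refine lintegral_congr fun x => ?_
    by_cases hx : x ∈ B <;> simp [hx]

theorem parKernel_isReversible (p : ProbDensity lam) (q : ProposalDensity lam)
    (a : AcceptanceProb X)
    (h : ∀ x y, p.dens x * (q.dens x y * a.prob x y) = p.dens y * (q.dens y x * a.prob y x)) :
    (parKernel q a).IsReversible p.measure := by
  intro A B hA hB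
  have hflow : Measurable fun z : X × X =>
      ENNReal.ofReal (p.dens z.1 * (q.dens z.1 z.2 * a.prob z.1 z.2)) :=
    ((p.measurable.comp measurable_fst).mul (q.measurable.mul a.measurable)).ennreal_ofReal
  rw [setLIntegral_parKernel_apply p q a hA hB, setLIntegral_parKernel_apply p q a hB hA,
    Set.inter_comm B A, lintegral_lintegral_swap hflow.aemeasurable]
  simp_rw [h]

theorem mhKernel_isReversible (p : ProbDensity lam) (q : ProposalDensity lam) :
    (mhKernel p q).IsReversible p.measure := by
  refine parKernel_isReversible p q _ fun x y => ?_
  have hflow : ∀ x y, p.dens x * (q.dens x y * (mhAcceptance p q).prob x y) =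
      min (p.dens x * q.dens x y) (p.dens y * q.dens y x) := fun x y => by
    rw [← mul_assoc]
    exact mul_acceptRatio (mul_nonneg (p.nonneg y) (q.nonneg y x))
      (mul_nonneg (p.nonneg x) (q.nonneg x y))
  rw [hflow, hflow, min_comm]

theorem daKernel_isReversible (p s : ProbDensity lam) (q : ProposalDensity lam)
    (hps : ∀ x, s.dens x = 0 → p.dens x = 0) :
    (daKernel p s q).IsReversible p.measure := by
  refine parKernel_isReversible p q _ fun x y => ?_
  have hflow : ∀ x y, p.dens x * (q.dens x y * (daAcceptance p s q).prob x y) =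
      min (s.dens x * q.dens x y) (s.dens y * q.dens y x) *
        min (p.dens x / s.dens x) (p.dens y / s.dens y) := fun x y => by
    rw [← mul_acceptRatio (mul_nonneg (s.nonneg y) (q.nonneg y x))
        (mul_nonneg (s.nonneg x) (q.nonneg x y)),
      ← mul_acceptRatio (div_nonneg (p.nonneg y) (s.nonneg y))
        (div_nonneg (p.nonneg x) (s.nonneg x))]
    nth_rw 1 [← div_mul_cancel_of_imp (hps x)]
    simp only [daAcceptance]
    ring
  rw [hflow, hflow, min_comm, min_comm (p.dens y / s.dens y)]

end Reversibility

section IndependenceSampler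

variable {X : Type*} [MeasurableSpace X] {lam : Measure X}

theorem lintegral_acceptedDensity_independenceProposal (p : ProbDensity lam)
    (a : AcceptanceProb X) (x : X) :
    ∫⁻ y, acceptedDensity (independenceProposal p) a x y ∂lam =
      ∫⁻ y, ENNReal.ofReal (a.prob x y) ∂p.measure := by
  rw [p.lintegral_measure]
  exact lintegral_congr fun y => ENNReal.ofReal_mul (p.nonneg y)

theorem mhAcceptance_independenceProposal_self (p : ProbDensity lam) (x y : X) :
    (mhAcceptance p (independenceProposal p)).prob x y = 1 := by
  change acceptRatio (p.dens y * p.dens x) (p.dens x * p.dens y) = 1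
  rw [acceptRatio, mul_comm]
  split_ifs with h
  · rfl
  · rw [div_self h, min_self]

theorem mhKernel_independenceProposal_self [SFinite lam] (p : ProbDensity lam) :
    mhKernel p (independenceProposal p) = Kernel.const X p.measure := by
  ext x s hs
  have hacc : ∀ y, acceptedDensity (independenceProposal p)
      (mhAcceptance p (independenceProposal p)) x y = ENNReal.ofReal (p.dens y) := fun y => by
    rw [acceptedDensity, mhAcceptance_independenceProposal_self, mul_one]
    rfl
  rw [mhKernel, parKernel_apply _ _ _ hs]
  simp_rw [hacc]
  rw [p.lintegral_eq_one, tsub_self, zero_mul, add_zero, Kernel.const_apply,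
    ProbDensity.measure, withDensity_apply _ hs]

theorem daAcceptance_independenceProposal_self (p s : ProbDensity lam) {x y : X}
    (hpx : 0 < p.dens x) (hpy : 0 < p.dens y) (hsx : 0 < s.dens x) (hsy : 0 < s.dens y) :
    (daAcceptance p s (independenceProposal p)).prob x y =
      min (s.dens y * p.dens x / (s.dens x * p.dens y))
        (s.dens y * p.dens x / (s.dens x * p.dens y))⁻¹ := by
  set r := s.dens y * p.dens x / (s.dens x * p.dens y) with hr
  have hr0 : 0 < r := by positivity
  have hsecond : p.dens y / s.dens y / (p.dens x / s.dens x) = r⁻¹ := by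
    rw [hr]
    field_simp
  change acceptRatio (s.dens y * p.dens x) (s.dens x * p.dens y) *
    acceptRatio (p.dens y / s.dens y) (p.dens x / s.dens x) = _
  rw [acceptRatio, acceptRatio, if_neg (by positivity), if_neg (by positivity), hsecond, ← hr]
  rcases le_total r 1 with h | h
  · have hinv : 1 ≤ r⁻¹ := (one_le_inv₀ hr0).2 h
    rw [min_eq_right h, min_eq_left hinv, min_eq_left (h.trans hinv), mul_one]
  · have hinv : r⁻¹ ≤ 1 := inv_le_one_of_one_le₀ h
    rw [min_eq_left h, min_eq_right hinv, min_eq_right (hinv.trans h), one_mul]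

end IndependenceSampler

section Holding

variable {X : Type*} [MeasurableSpace X]

theorem parKernel_apply_compl_singleton_le [MeasurableSingletonClass X] {lam : Measure X}
    [SFinite lam] (q : ProposalDensity lam) (a : AcceptanceProb X) (x : X) :
    parKernel q a x {x}ᶜ ≤ ∫⁻ y, acceptedDensity q a x y ∂lam := by
  rw [parKernel_apply q a x (measurableSet_singleton x).compl, Set.indicator_of_notMem (by simp),
    mul_zero, add_zero]
  exact setLIntegral_le_lintegral _ _

theorem isMarkovKernel_pow (P : Kernel X X) [IsMarkovKernel P] (n : ℕ) :
    IsMarkovKernel (P ^ n) := by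
  induction n with
  | zero => exact inferInstanceAs (IsMarkovKernel Kernel.id)
  | succ n ih => exact inferInstanceAs (IsMarkovKernel ((P ^ n) ∘ₖ P))

theorem apply_singleton_pow_le_pow_apply_singleton [MeasurableSingletonClass X] (P : Kernel X X)
    (x : X) (n : ℕ) : P x {x} ^ n ≤ (P ^ n) x {x} := by
  induction n with
  | zero =>
    change _ ≤ Kernel.id x {x}
    simp [Kernel.id_apply]
  | succ n ih =>
    rw [Kernel.pow_succ_apply_eq_lintegral _ _ _ (measurableSet_singleton x)]
    calc P x {x} ^ (n + 1) ≤ P x {x} * (P ^ n) x {x} := by rw [pow_succ']; gcongr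
      _ = ∫⁻ y in {x}, P y {x} ∂((P ^ n) x) := by rw [lintegral_singleton]
      _ ≤ ∫⁻ y, P y {x} ∂((P ^ n) x) := setLIntegral_le_lintegral _ _

theorem one_le_pow_add_mul {p e : ℝ≥0∞} (h : p + e = 1) (n : ℕ) : 1 ≤ p ^ n + n * e := by
  induction n with
  | zero => simp
  | succ n ih =>
    have hp : p ≤ 1 := h ▸ le_self_add
    calc 1 = p + e := h.symm
      _ ≤ p * (p ^ n + n * e) + e := by gcongr; exact le_mul_of_one_le_right' ih
      _ ≤ p ^ (n + 1) + (1 * (n * e) + e) := by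
        rw [mul_add, ← pow_succ', add_assoc]
        gcongr
      _ = p ^ (n + 1) + (n + 1 : ℕ) * e := by push_cast; ring

theorem half_le_apply_singleton_pow [MeasurableSingletonClass X] {P : Kernel X X}
    [IsMarkovKernel P] {x : X} {n : ℕ} (h : n * P x {x}ᶜ ≤ 1 / 2) :
    1 / 2 ≤ P x {x} ^ n := by
  have hone : 1 / 2 + 1 / 2 ≤ P x {x} ^ n + 1 / 2 :=
    calc (1 / 2 + 1 / 2 : ℝ≥0∞) = 1 := ENNReal.add_halves 1
      _ ≤ P x {x} ^ n + n * P x {x}ᶜ :=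
        one_le_pow_add_mul (prob_add_prob_compl (measurableSet_singleton x)) n
      _ ≤ P x {x} ^ n + 1 / 2 := by gcongr
  exact (ENNReal.add_le_add_iff_right (by simp)).1 hone

end Holding

section GeometricErgodicity

variable {X : Type*} [MeasurableSpace X]

theorem tvDist_self (μ : Measure X) : tvDist μ μ = 0 := by
  simp [tvDist]

theorem tvDist_le_one (μ ν : Measure X) [IsProbabilityMeasure μ] [IsProbabilityMeasure ν] :
    tvDist μ ν ≤ 1 := by
  refine iSup₂_le fun A _ => ENNReal.ofReal_le_one.2 (abs_sub_le_iff.2 ⟨?_, ?_⟩) <;>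
    linarith [measureReal_nonneg (μ := μ) (s := A), measureReal_nonneg (μ := ν) (s := A),
      measureReal_le_one (μ := μ) (s := A), measureReal_le_one (μ := ν) (s := A)]

theorem apply_le_tvDist_of_apply_eq_zero {μ ν : Measure X} [IsFiniteMeasure μ] {A : Set X}
    (hA : MeasurableSet A) (hν : ν A = 0) : μ A ≤ tvDist μ ν :=
  calc μ A = ENNReal.ofReal |μ.real A - ν.real A| := by simp [measureReal_def, hν]
    _ ≤ tvDist μ ν := le_iSup₂ (f := fun (A : Set X) (_ : MeasurableSet A) =>
      ENNReal.ofReal |μ.real A - ν.real A|) A hA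

theorem geometricallyErgodic_const (π : Measure X) [IsProbabilityMeasure π] :
    GeometricallyErgodic (Kernel.const X π) π := by
  refine ⟨0, zero_lt_one, fun _ => 1, ae_of_all _ fun x n => ?_⟩
  have hmarkov := isMarkovKernel_pow (Kernel.const X π)
  have hle : tvDist ((Kernel.const X π ^ n) x) π ≤ 1 := tvDist_le_one _ _
  cases n with
  | zero => rwa [pow_zero (M := ℝ≥0∞), ENNReal.coe_one, one_mul]
  | succ n =>
    have hpow : (Kernel.const X π ^ (n + 1)) x = π := by
      ext s hs
      simp [Kernel.pow_succ_apply_eq_lintegral _ _ _ hs]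
    rw [hpow, tvDist_self]
    exact zero_le

theorem le_of_forall_pow_le_mul_pow {s ρ C : ℝ≥0} (h : ∀ n : ℕ, s ^ n ≤ C * ρ ^ n) : s ≤ ρ := by
  by_contra! hlt
  have hs : 0 < s := bot_lt_of_lt hlt
  have hone : ∀ n : ℕ, 1 ≤ C * (ρ / s) ^ n := fun n => by
    rw [div_pow, mul_div_assoc', one_le_div (pow_pos hs n)]
    exact h n
  have hlim : Tendsto (fun n : ℕ => C * (ρ / s) ^ n) atTop (nhds (C * 0)) :=
    (tendsto_pow_atTop_nhds_zero_of_lt_one zero_le ((div_lt_one hs).2 hlt)).const_mul C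
  simpa using ge_of_tendsto' hlim hone

/- As `π` does not charge `{x}`, the total variation distance of `Pⁿ(x, ·)` to `π` is at least
`P(x, {x})ⁿ`. -/
theorem GeometricallyErgodic.exists_pos_le_apply_compl_singleton [MeasurableSingletonClass X]
    {P : Kernel X X} [IsMarkovKernel P] {π : Measure X} [NullSingletonClass π]
    (hP : GeometricallyErgodic P π) : ∃ ε : ℝ≥0∞, 0 < ε ∧ ∀ᵐ x ∂π, ε ≤ P x {x}ᶜ := by
  obtain ⟨ρ, hρ, C, hC⟩ := hP
  refine ⟨1 - ρ, tsub_pos_of_lt (by exact_mod_cast hρ), ?_⟩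
  filter_upwards [hC] with x hx
  have := isMarkovKernel_pow P
  have hpow : ∀ n : ℕ, P x {x} ^ n ≤ C x * (ρ : ℝ≥0∞) ^ n := fun n =>
    (apply_singleton_pow_le_pow_apply_singleton P x n).trans
      ((apply_le_tvDist_of_apply_eq_zero (measurableSet_singleton x)
        (measure_singleton x)).trans (hx n))
  obtain ⟨s, hs⟩ : ∃ s : ℝ≥0, s = P x {x} := ⟨_, ENNReal.coe_toNNReal (measure_ne_top _ _)⟩
  simp only [← hs] at hpow
  have hle : s ≤ ρ := le_of_forall_pow_le_mul_pow fun n => by exact_mod_cast hpow n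
  rw [prob_compl_eq_one_sub (measurableSet_singleton x), ← hs]
  gcongr

end GeometricErgodicity

section Conductance

theorem conductance_le_of_forall_mem {X : Type*} [MeasurableSpace X] {P : Kernel X X}
    {π : Measure X} {A : Set X} (hA : MeasurableSet A) (hpos : 0 < π A) (hhalf : π A ≤ 1 / 2)
    {ε : ℝ≥0∞} (hε : ∀ x ∈ A, P x Aᶜ ≤ ε) : conductance P π ≤ ε :=
  calc conductance P π ≤ escapeProb P π A := iInf₂_le_of_le A hA (iInf₂_le hpos hhalf)
    _ ≤ ε := ENNReal.div_le_of_le_mul <| by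
      rw [← setLIntegral_const]
      exact setLIntegral_mono' hA hε

end Conductance

section StationaryChain

variable {X : Type*} [MeasurableSpace X] {P : Kernel X X} [IsMarkovKernel P] {π : Measure X}

instance chainLaw.instIsProbabilityMeasure [IsProbabilityMeasure π] :
    IsProbabilityMeasure (chainLaw P π) :=
  inferInstanceAs (IsProbabilityMeasure (Kernel.trajMeasure (X := fun _ => X) π _))

theorem chainLaw_map_zero : (chainLaw P π).map (fun ω => ω 0) = π := by
  have h : (fun ω : ℕ → X => ω 0) =
      (fun x : (i : Finset.Iic 0) → X => x ⟨0, Finset.mem_Iic.2 le_rfl⟩) ∘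
        Preorder.frestrictLe (π := fun _ => X) 0 := rfl
  rw [h, ← Measure.map_map (measurable_pi_apply _) (by fun_prop), chainLaw, Kernel.trajMeasure,
    Measure.map_comp _ _ (by fun_prop), Kernel.traj_map_frestrictLe, Kernel.partialTraj_self,
    Measure.id_comp, Measure.map_map (measurable_pi_apply _) (by fun_prop)]
  exact Measure.map_id

variable [IsProbabilityMeasure π]

theorem lintegral_chainLaw_succ {n : ℕ} {f : (Finset.Iic n → X) → X → ℝ≥0∞}
    (hf : Measurable (Function.uncurry f)) :
    ∫⁻ ω, f (Preorder.frestrictLe n ω) (ω (n + 1)) ∂chainLaw P π =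
      ∫⁻ ω, ∫⁻ y, f (Preorder.frestrictLe n ω) y ∂P (ω n) ∂chainLaw P π := by
  set κ : Kernel (Finset.Iic n → X) X :=
    P.comap (fun x => x ⟨n, Finset.mem_Iic.2 le_rfl⟩) (measurable_pi_apply _)
  have hlaw : (chainLaw P π).map (fun ω => (Preorder.frestrictLe n ω, ω (n + 1))) =
      (chainLaw P π).map (Preorder.frestrictLe n) ⊗ₘ κ :=
    (Kernel.map_frestrictLe_trajMeasure_compProd_eq_map_trajMeasure (X := fun _ => X)).symm
  calc ∫⁻ ω, f (Preorder.frestrictLe n ω) (ω (n + 1)) ∂chainLaw P π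
      = ∫⁻ z, Function.uncurry f z ∂(chainLaw P π).map
          (fun ω => (Preorder.frestrictLe n ω, ω (n + 1))) := by
        rw [lintegral_map hf (by fun_prop)]
        rfl
    _ = ∫⁻ x, ∫⁻ y, f x y ∂κ x ∂(chainLaw P π).map (Preorder.frestrictLe n) := by
        rw [hlaw, Measure.lintegral_compProd hf]
        rfl
    _ = ∫⁻ ω, ∫⁻ y, f (Preorder.frestrictLe n ω) y ∂P (ω n) ∂chainLaw P π :=
        lintegral_map (f := fun x => ∫⁻ y, f x y ∂κ x) hf.lintegral_kernel_prod_right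
          (Preorder.measurable_frestrictLe n)

theorem chainLaw_map_eval (hP : P.Invariant π) (n : ℕ) :
    (chainLaw P π).map (fun ω => ω n) = π := by
  induction n with
  | zero => exact chainLaw_map_zero
  | succ n ih =>
    refine Measure.ext_of_lintegral _ fun f hf => ?_
    calc ∫⁻ x, f x ∂(chainLaw P π).map (fun ω => ω (n + 1))
        = ∫⁻ ω, f (ω (n + 1)) ∂chainLaw P π := lintegral_map hf (measurable_pi_apply _)
      _ = ∫⁻ ω, ∫⁻ y, f y ∂P (ω n) ∂chainLaw P π :=
          lintegral_chainLaw_succ (f := fun _ => f) (hf.comp measurable_snd)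
      _ = ∫⁻ x, ∫⁻ y, f y ∂P x ∂(chainLaw P π).map (fun ω => ω n) :=
          (lintegral_map hf.lintegral_kernel (measurable_pi_apply _)).symm
      _ = ∫⁻ x, f x ∂π := by
          rw [ih, ← Measure.lintegral_bind P.aemeasurable hf.aemeasurable, hP.def]

theorem integral_mean_chainLaw (hP : P.Invariant π) {h : X → ℝ} (hh : Integrable h π) {n : ℕ}
    (hn : n ≠ 0) :
    ∫ ω, (n : ℝ)⁻¹ * ∑ i ∈ Finset.range n, h (ω i) ∂chainLaw P π = ∫ x, h x ∂π := by
  have hmp : ∀ i, MeasurePreserving (fun ω : ℕ → X => ω i) (chainLaw P π) π := fun i =>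
    ⟨measurable_pi_apply i, chainLaw_map_eval hP i⟩
  have hint : ∀ i, Integrable (fun ω => h (ω i)) (chainLaw P π) := fun i =>
    (hmp i).integrable_comp_of_integrable hh
  have hmean : ∀ i, ∫ ω, h (ω i) ∂chainLaw P π = ∫ x, h x ∂π := fun i => by
    have hmap := (hmp i).map_eq
    rw [← integral_map (hmp i).aemeasurable (by rw [hmap]; exact hh.aestronglyMeasurable), hmap]
  rw [integral_const_mul, integral_finsetSum _ fun i _ => hint i]
  simp_rw [hmean]
  rw [Finset.sum_const, Finset.card_range, nsmul_eq_mul,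
    inv_mul_cancel_left₀ (Nat.cast_ne_zero.2 hn)]

end StationaryChain

section VarianceLowerBound

variable {X : Type*} [MeasurableSpace X] [MeasurableEq X]

/-- The paths of a chain that have not left their starting point up to time `n`. -/
def heldUntil (X : Type*) (n : ℕ) : Set (ℕ → X) :=
  {ω | ∀ i ≤ n, ω i = ω 0}

theorem measurableSet_heldUntil (n : ℕ) : MeasurableSet (heldUntil X n) := by
  simp only [heldUntil, Set.ofPred_forall]
  exact MeasurableSet.iInter fun i => MeasurableSet.iInter fun _ =>
    measurableSet_eq_fun (measurable_pi_apply i) (measurable_pi_apply 0)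

variable {P : Kernel X X} [IsMarkovKernel P] {π : Measure X} [IsProbabilityMeasure π]

theorem measurable_apply_singleton : Measurable fun x => P x {x} := by
  have h : ∀ x : X, Prod.mk x ⁻¹' Set.diagonal X = {x} := fun x => by
    ext y
    simp [eq_comm]
  simpa only [h] using Kernel.measurable_kernel_prodMk_left (κ := P) measurableSet_diagonal

theorem setLIntegral_heldUntil_succ {f : X → ℝ≥0∞} (hf : Measurable f) (n : ℕ) :
    ∫⁻ ω in heldUntil X (n + 1), f (ω 0) ∂chainLaw P π =
      ∫⁻ ω in heldUntil X n, f (ω 0) * P (ω 0) {ω 0} ∂chainLaw P π := by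
  let zero : Finset.Iic n := ⟨0, Finset.mem_Iic.2 n.zero_le⟩
  let constant : Set (Finset.Iic n → X) := {x | ∀ i, x i = x zero}
  let F : (Finset.Iic n → X) → X → ℝ≥0∞ := fun x y =>
    constant.indicator (fun x => f (x zero)) x * ({x zero} : Set X).indicator 1 y
  have hconstant : MeasurableSet constant := by
    simp only [constant, Set.ofPred_forall]
    exact MeasurableSet.iInter fun i =>
      measurableSet_eq_fun (measurable_pi_apply i) (measurable_pi_apply zero)
  have hF : Measurable (Function.uncurry F) := by
    have hstay : MeasurableSet {z : (Finset.Iic n → X) × X | z.2 = z.1 zero} :=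
      measurableSet_eq_fun measurable_snd ((measurable_pi_apply zero).comp measurable_fst)
    exact (((hf.comp (measurable_pi_apply zero)).indicator hconstant).comp measurable_fst).mul
      (measurable_one.indicator hstay)
  have hheld : ∀ ω : ℕ → X, Preorder.frestrictLe n ω ∈ constant ↔ ω ∈ heldUntil X n := fun ω =>
    ⟨fun h i hi => h ⟨i, Finset.mem_Iic.2 hi⟩, fun h i => h i (Finset.mem_Iic.1 i.2)⟩
  calc ∫⁻ ω in heldUntil X (n + 1), f (ω 0) ∂chainLaw P π
      = ∫⁻ ω, F (Preorder.frestrictLe n ω) (ω (n + 1)) ∂chainLaw P π := by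
        rw [← lintegral_indicator (measurableSet_heldUntil _)]
        refine lintegral_congr fun ω => ?_
        have hsucc : ω ∈ heldUntil X (n + 1) ↔ ω ∈ heldUntil X n ∧ ω (n + 1) = ω 0 := by
          simp only [heldUntil, Set.mem_ofPred_eq, Nat.le_succ_iff, or_imp, forall_and, forall_eq]
        by_cases h : ω ∈ heldUntil X n <;> by_cases h' : ω (n + 1) = ω 0 <;>
          simp [F, hsucc, hheld, h, h', zero]
    _ = ∫⁻ ω, ∫⁻ y, F (Preorder.frestrictLe n ω) y ∂P (ω n) ∂chainLaw P π :=
        lintegral_chainLaw_succ hF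
    _ = ∫⁻ ω in heldUntil X n, f (ω 0) * P (ω 0) {ω 0} ∂chainLaw P π := by
        rw [← lintegral_indicator (measurableSet_heldUntil _)]
        refine lintegral_congr fun ω => ?_
        by_cases h : ω ∈ heldUntil X n
        · have hfst : ω n = ω 0 := h n le_rfl
          simp only [F, zero, Set.indicator_of_mem ((hheld ω).2 h), Set.indicator_of_mem h, hfst]
          rw [lintegral_const_mul _ (measurable_one.indicator (measurableSet_singleton _)),
            lintegral_indicator_one (measurableSet_singleton _)]
          rfl
        · simp [F, h, hheld]

theorem setLIntegral_heldUntil {f : X → ℝ≥0∞} (hf : Measurable f) (n : ℕ) :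
    ∫⁻ ω in heldUntil X n, f (ω 0) ∂chainLaw P π = ∫⁻ x, f x * P x {x} ^ n ∂π := by
  induction n generalizing f with
  | zero =>
    have huniv : heldUntil X 0 = Set.univ := by
      ext ω
      simp [heldUntil]
    rw [huniv, Measure.restrict_univ, ← lintegral_map hf (measurable_pi_apply 0),
      chainLaw_map_zero]
    simp only [pow_zero, mul_one]
  | succ n ih =>
    rw [setLIntegral_heldUntil_succ hf,
      ih (f := fun x => f x * P x {x}) (hf.mul measurable_apply_singleton)]
    simp only [pow_succ', mul_assoc]

/- While the chain is held at its starting point `x`, the empirical mean is exactly `h x`. -/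
theorem lintegral_mul_pow_le_evariance_mean (hP : P.Invariant π) {h : X → ℝ} (hm : Measurable h)
    (hh : Integrable h π) {n : ℕ} (hn : n ≠ 0) :
    ∫⁻ x, ‖h x - ∫ z, h z ∂π‖ₑ ^ 2 * P x {x} ^ n ∂π ≤
      evariance (fun ω : ℕ → X => (n : ℝ)⁻¹ * ∑ i ∈ Finset.range n, h (ω i))
        (chainLaw P π) := by
  have hmean : ∀ ω ∈ heldUntil X n, (n : ℝ)⁻¹ * ∑ i ∈ Finset.range n, h (ω i) = h (ω 0) := by
    intro ω hω
    rw [Finset.sum_congr rfl fun i hi => by rw [hω i (Finset.mem_range.1 hi).le],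
      Finset.sum_const, Finset.card_range, nsmul_eq_mul,
      inv_mul_cancel_left₀ (Nat.cast_ne_zero.2 hn)]
  rw [evariance, integral_mean_chainLaw hP hh hn,
    ← setLIntegral_heldUntil ((hm.sub_const _).enorm.pow_const 2)]
  calc ∫⁻ ω in heldUntil X n, ‖h (ω 0) - ∫ z, h z ∂π‖ₑ ^ 2 ∂chainLaw P π
      = ∫⁻ ω in heldUntil X n,
          ‖(n : ℝ)⁻¹ * ∑ i ∈ Finset.range n, h (ω i) - ∫ z, h z ∂π‖ₑ ^ 2 ∂chainLaw P π :=
        setLIntegral_congr_fun (measurableSet_heldUntil n) fun ω hω => by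
          simp only [hmean ω hω]
    _ ≤ _ := setLIntegral_le_lintegral _ _

/- A chain started in `A n` is held at its starting point up to time `n` with probability at
least `1/2`. -/
theorem asymptoticVariance_eq_top (hP : P.Invariant π) {h : X → ℝ} (hm : Measurable h)
    (hh : Integrable h π) {A : ℕ → Set X} (hA : ∀ n, MeasurableSet (A n))
    (hescape : ∀ᶠ n : ℕ in atTop, ∀ x ∈ A n, n * P x {x}ᶜ ≤ 1 / 2)
    (hdev : Tendsto (fun n : ℕ => n * ∫⁻ x in A n, ‖h x - ∫ z, h z ∂π‖ₑ ^ 2 ∂π) atTop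
      (nhds ⊤)) :
    asymptoticVariance P π h = ⊤ := by
  have hlim : Tendsto (fun n : ℕ => 1 / 2 * (n * ∫⁻ x in A n, ‖h x - ∫ z, h z ∂π‖ₑ ^ 2 ∂π))
      atTop (nhds ⊤) := by
    simpa using ENNReal.Tendsto.const_mul (a := 1 / 2) hdev (Or.inl ENNReal.top_ne_zero)
  refine (tendsto_nhds_top_mono hlim ?_).limsup_eq
  filter_upwards [hescape, eventually_ne_atTop 0] with n hn hn0
  rw [mul_left_comm]
  gcongr
  calc 1 / 2 * ∫⁻ x in A n, ‖h x - ∫ z, h z ∂π‖ₑ ^ 2 ∂π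
      = ∫⁻ x in A n, ‖h x - ∫ z, h z ∂π‖ₑ ^ 2 * (1 / 2) ∂π := by
        rw [mul_comm, lintegral_mul_const _ ((hm.sub_const _).enorm.pow_const 2)]
    _ ≤ ∫⁻ x in A n, ‖h x - ∫ z, h z ∂π‖ₑ ^ 2 * P x {x} ^ n ∂π :=
        setLIntegral_mono' (hA n) fun x hx => by
          gcongr
          exact half_le_apply_singleton_pow (hn x hx)
    _ ≤ ∫⁻ x, ‖h x - ∫ z, h z ∂π‖ₑ ^ 2 * P x {x} ^ n ∂π := setLIntegral_le_lintegral _ _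
    _ ≤ _ := lintegral_mul_pow_le_evariance_mean hP hm hh hn0

end VarianceLowerBound

section ExponentialLaw

instance ProbDensity.instNullSingletonClass {X : Type*} [MeasurableSpace X] {lam : Measure X}
    [NullSingletonClass lam] (p : ProbDensity lam) : NullSingletonClass p.measure :=
  nullSingletonClass_withDensity _

variable {c : ℝ} (hc : 0 < c)

theorem expDensity_dens_of_pos {y : ℝ} (hy : 0 < y) :
    (expDensity c hc).dens y = c * Real.exp (-(c * y)) :=
  if_pos hy

theorem expDensity_dens_pos_iff {y : ℝ} : 0 < (expDensity c hc).dens y ↔ 0 < y := by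
  refine ⟨fun h => ?_, fun hy => ?_⟩
  · by_contra hy
    exact h.ne' (if_neg hy)
  · rw [expDensity_dens_of_pos hc hy]
    positivity

theorem ae_pos_expDensity : ∀ᵐ y ∂(expDensity c hc).measure, 0 < y := by
  rw [ProbDensity.measure, ae_withDensity_iff (expDensity c hc).measurable.ennreal_ofReal]
  refine ae_of_all _ fun y hy => ?_
  rwa [ne_eq, ENNReal.ofReal_eq_zero, not_le, expDensity_dens_pos_iff] at hy

theorem setLIntegral_exp_mul_expDensity {β t : ℝ} (hβ : β < c) (ht : 0 ≤ t) :
    ∫⁻ y in Set.Ioi t, ENNReal.ofReal (Real.exp (β * y)) ∂(expDensity c hc).measure =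
      ENNReal.ofReal (c / (c - β) * Real.exp (-((c - β) * t))) := by
  have hneg : β - c < 0 := sub_neg.2 hβ
  rw [ProbDensity.setLIntegral_measure _ _ measurableSet_Ioi]
  calc ∫⁻ y in Set.Ioi t, ENNReal.ofReal ((expDensity c hc).dens y) *
        ENNReal.ofReal (Real.exp (β * y))
      = ∫⁻ y in Set.Ioi t, ENNReal.ofReal (c * Real.exp ((β - c) * y)) :=
        setLIntegral_congr_fun measurableSet_Ioi fun y hy => by
          simp only [expDensity_dens_of_pos hc (ht.trans_lt hy)]
          rw [← ENNReal.ofReal_mul (by positivity), mul_assoc, ← Real.exp_add]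
          ring_nf
    _ = ENNReal.ofReal (∫ y in Set.Ioi t, c * Real.exp ((β - c) * y)) :=
        (ofReal_integral_eq_lintegral_ofReal ((integrableOn_exp_mul_Ioi hneg t).const_mul c)
          (ae_of_all _ fun y => by positivity)).symm
    _ = ENNReal.ofReal (c / (c - β) * Real.exp (-((c - β) * t))) := by
        rw [integral_const_mul, integral_exp_mul_Ioi hneg, ← neg_mul, neg_sub, ← neg_sub c β,
          neg_div_neg_eq, mul_div_assoc', div_mul_eq_mul_div]

theorem lintegral_exp_mul_expDensity {β : ℝ} (hβ : β < c) :
    ∫⁻ y, ENNReal.ofReal (Real.exp (β * y)) ∂(expDensity c hc).measure =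
      ENNReal.ofReal (c / (c - β)) := by
  have hsupport : (expDensity c hc).measure.restrict (Set.Ioi 0) = (expDensity c hc).measure :=
    Measure.restrict_eq_self_of_ae_mem (ae_pos_expDensity hc)
  have h := setLIntegral_exp_mul_expDensity hc hβ le_rfl
  rwa [hsupport, mul_zero, neg_zero, Real.exp_zero, mul_one] at h

theorem expDensity_measure_Ioi {t : ℝ} (ht : 0 ≤ t) :
    (expDensity c hc).measure (Set.Ioi t) = ENNReal.ofReal (Real.exp (-(c * t))) := by
  simpa [hc.ne'] using setLIntegral_exp_mul_expDensity hc (β := 0) hc ht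

theorem memLp_exp_mul_expDensity {γ : ℝ} (hγ : 2 * γ < c) :
    MemLp (fun x => Real.exp (γ * x)) 2 (expDensity c hc).measure := by
  have hmeas : Measurable fun x : ℝ => Real.exp (γ * x) := by fun_prop
  rw [memLp_two_iff_integrable_sq hmeas.aestronglyMeasurable]
  refine ⟨(hmeas.pow_const 2).aestronglyMeasurable, ?_⟩
  rw [hasFiniteIntegral_iff_ofReal (ae_of_all _ fun x => by positivity)]
  simp_rw [← Real.exp_nat_mul, Nat.cast_ofNat, ← mul_assoc]
  rw [lintegral_exp_mul_expDensity hc hγ]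
  exact ENNReal.ofReal_lt_top

theorem le_setLIntegral_sq_exp_mul_sub {γ t m : ℝ} (hγ : 0 ≤ γ) (ht : 0 ≤ t)
    (hm : 2 * m ≤ Real.exp (γ * t)) :
    ENNReal.ofReal (Real.exp (-((c - 2 * γ) * t)) / 4) ≤
      ∫⁻ x in Set.Ioi t, ‖Real.exp (γ * x) - m‖ₑ ^ 2 ∂(expDensity c hc).measure := by
  have hdev : ∀ x ∈ Set.Ioi t,
      ENNReal.ofReal (Real.exp (γ * t) / 2) ^ 2 ≤ ‖Real.exp (γ * x) - m‖ₑ ^ 2 := by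
    intro x hx
    have hmono : Real.exp (γ * t) ≤ Real.exp (γ * x) :=
      Real.exp_le_exp.2 (mul_le_mul_of_nonneg_left (le_of_lt hx) hγ)
    gcongr
    rw [← ofReal_norm]
    exact ENNReal.ofReal_le_ofReal (le_trans (by linarith) (Real.le_norm_self _))
  calc ENNReal.ofReal (Real.exp (-((c - 2 * γ) * t)) / 4)
      = ENNReal.ofReal (Real.exp (γ * t) / 2) ^ 2 * (expDensity c hc).measure (Set.Ioi t) := by
        rw [expDensity_measure_Ioi hc ht, ← ENNReal.ofReal_pow (by positivity),
          ← ENNReal.ofReal_mul (by positivity), div_pow, ← Real.exp_nat_mul, div_mul_eq_mul_div,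
          ← Real.exp_add]
        push_cast
        ring_nf
    _ ≤ _ := by
        rw [← setLIntegral_const]
        exact setLIntegral_mono' measurableSet_Ioi hdev

end ExponentialLaw

section ExponentialTestFunctions

theorem tendsto_log_four_mul_div_atTop {β : ℝ} (hβ : 0 < β) :
    Tendsto (fun n : ℕ => Real.log (4 * n) / β) atTop atTop :=
  (Real.tendsto_log_atTop.comp
    (tendsto_natCast_atTop_atTop.const_mul_atTop four_pos)).atTop_div_const hβ

theorem exp_mul_log_four_mul_div {β : ℝ} (hβ : β ≠ 0) {n : ℕ} (hn : n ≠ 0) :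
    Real.exp (β * (Real.log (4 * n) / β)) = 4 * n := by
  rw [mul_div_cancel₀ _ hβ, Real.exp_log (by positivity)]

theorem tendsto_mul_setLIntegral_sq_exp_mul_sub {c β γ : ℝ} (hc : 0 < c) (hβ : 0 < β) (hγ : 0 < γ)
    (hγβ : c - 2 * γ < β) (m : ℝ) :
    Tendsto (fun n : ℕ => n * ∫⁻ x in Set.Ioi (Real.log (4 * n) / β),
      ‖Real.exp (γ * x) - m‖ₑ ^ 2 ∂(expDensity c hc).measure) atTop (nhds ⊤) := by
  set t : ℕ → ℝ := fun n => Real.log (4 * n) / β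
  have ht : Tendsto t atTop atTop := tendsto_log_four_mul_div_atTop hβ
  have hdiv : Tendsto (fun n => ENNReal.ofReal (Real.exp ((β - (c - 2 * γ)) * t n) / 16)) atTop
      (nhds ⊤) :=
    ENNReal.tendsto_ofReal_atTop.comp ((Real.tendsto_exp_atTop.comp
      (ht.const_mul_atTop (sub_pos.2 hγβ))).atTop_div_const (by norm_num))
  have hgrow : Tendsto (fun n => Real.exp (γ * t n)) atTop atTop :=
    Real.tendsto_exp_atTop.comp (ht.const_mul_atTop hγ)
  refine tendsto_nhds_top_mono hdiv ?_
  filter_upwards [ht.eventually_ge_atTop 0, eventually_ne_atTop 0,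
    hgrow.eventually_ge_atTop (2 * m)] with n htn hn hm
  calc ENNReal.ofReal (Real.exp ((β - (c - 2 * γ)) * t n) / 16)
      = n * ENNReal.ofReal (Real.exp (-((c - 2 * γ) * t n)) / 4) := by
        rw [← ENNReal.ofReal_natCast, ← ENNReal.ofReal_mul n.cast_nonneg, sub_mul, sub_eq_add_neg,
          Real.exp_add, exp_mul_log_four_mul_div hβ.ne' hn]
        ring_nf
    _ ≤ _ := by
        gcongr
        exact le_setLIntegral_sq_exp_mul_sub hc hγ.le htn hm

/- A chain started above `t n = log (4 n) / β` moves within `n` steps with probability at most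
`1/2`, since `n * (2 * exp (-(β * t n))) = 1/2`. -/
theorem asymptoticVariance_exp_mul_eq_top {c β γ : ℝ} (hc : 0 < c) {P : Kernel ℝ ℝ}
    [IsMarkovKernel P] (hP : P.Invariant (expDensity c hc).measure) (hβ : 0 < β)
    (hescape : ∀ t, 0 ≤ t → ∀ x ∈ Set.Ioi t, P x {x}ᶜ ≤ ENNReal.ofReal (2 * Real.exp (-(β * t))))
    (hγ : 0 < γ) (hγc : 2 * γ < c) (hγβ : c - 2 * γ < β) :
    asymptoticVariance P (expDensity c hc).measure (fun x => Real.exp (γ * x)) = ⊤ := by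
  refine asymptoticVariance_eq_top hP (by fun_prop)
    ((memLp_exp_mul_expDensity hc hγc).integrable one_le_two)
    (fun n => measurableSet_Ioi (a := Real.log (4 * n) / β)) ?_
    (tendsto_mul_setLIntegral_sq_exp_mul_sub hc hβ hγ hγβ _)
  filter_upwards [(tendsto_log_four_mul_div_atTop hβ).eventually_ge_atTop 0,
    eventually_ne_atTop 0] with n hn_nonneg hn x hx
  calc n * P x {x}ᶜ
      ≤ n * ENNReal.ofReal (2 * Real.exp (-(β * (Real.log (4 * n) / β)))) := by
        gcongr
        exact hescape _ hn_nonneg x hx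
    _ = 1 / 2 := by
        rw [Real.exp_neg, exp_mul_log_four_mul_div hβ.ne' hn, ← ENNReal.ofReal_natCast,
          ← ENNReal.ofReal_mul n.cast_nonneg, ← ENNReal.ofReal_ofNat 2, ← ENNReal.ofReal_one,
          ← ENNReal.ofReal_div_of_pos two_pos]
        congr 1
        field_simp
        norm_num

end ExponentialTestFunctions

section ExponentialDelayedAcceptance

variable {k : ℝ} (hk : 0 < k)

theorem expDA_isReversible : (expDA k hk).IsReversible expLaw :=
  daKernel_isReversible _ _ _ fun x hx => by
    have hx0 : ¬ 0 < x := fun h => ((expDensity_dens_pos_iff hk).2 h).ne' hx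
    exact if_neg hx0

theorem geometricallyErgodic_expMH : GeometricallyErgodic expMH expLaw := by
  rw [expMH, mhKernel_independenceProposal_self]
  exact geometricallyErgodic_const _

theorem daAcceptance_expDensity {c x y : ℝ} (hc : 0 < c) (hx : 0 < x) (hy : 0 < y) :
    (daAcceptance (expDensity c hc) (expDensity k hk)
      (independenceProposal (expDensity c hc))).prob x y = Real.exp (-(|c - k| * |y - x|)) := by
  have hratio : k * Real.exp (-(k * y)) * (c * Real.exp (-(c * x))) /
      (k * Real.exp (-(k * x)) * (c * Real.exp (-(c * y)))) = Real.exp ((c - k) * (y - x)) := by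
    rw [mul_mul_mul_comm, mul_mul_mul_comm k _ c, mul_div_mul_left _ _ (by positivity),
      ← Real.exp_add, ← Real.exp_add, ← Real.exp_sub]
    ring_nf
  have hmin : ∀ u : ℝ, min u (-u) = -|u| := fun u => by
    rw [abs_eq_max_neg, ← min_neg_neg, neg_neg, min_comm]
  rw [daAcceptance_independenceProposal_self, expDensity_dens_of_pos hc hx,
    expDensity_dens_of_pos hc hy, expDensity_dens_of_pos hk hx, expDensity_dens_of_pos hk hy,
    hratio, ← Real.exp_neg, ← Real.exp_monotone.map_min, hmin, abs_mul]
  all_goals simpa only [expDensity_dens_pos_iff]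

theorem lintegral_acceptedDensity_expDensity_le {c β x : ℝ} (hc : 0 < c) (hβ : 0 ≤ β)
    (hβk : β ≤ |c - k|) (hβc : β < c) (hx : 0 < x) :
    ∫⁻ y, acceptedDensity (independenceProposal (expDensity c hc)) (daAcceptance (expDensity c hc)
      (expDensity k hk) (independenceProposal (expDensity c hc))) x y ≤
        ENNReal.ofReal (c / (c - β) * Real.exp (-(β * x))) := by
  rw [lintegral_acceptedDensity_independenceProposal]
  calc ∫⁻ y, ENNReal.ofReal ((daAcceptance (expDensity c hc) (expDensity k hk)
        (independenceProposal (expDensity c hc))).prob x y) ∂(expDensity c hc).measure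
      ≤ ∫⁻ y, ENNReal.ofReal (Real.exp (-(β * x))) * ENNReal.ofReal (Real.exp (β * y))
          ∂(expDensity c hc).measure := by
        refine lintegral_mono_ae ?_
        filter_upwards [ae_pos_expDensity hc] with y hy
        rw [daAcceptance_expDensity hk hc hx hy, ← ENNReal.ofReal_mul (by positivity),
          ← Real.exp_add]
        refine ENNReal.ofReal_le_ofReal (Real.exp_le_exp.2 ?_)
        have hdist : β * (x - y) ≤ |c - k| * |y - x| := by
          rw [abs_sub_comm y x]
          exact (mul_le_mul_of_nonneg_left (le_abs_self _) hβ).trans (by gcongr)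
        linarith
    _ = ENNReal.ofReal (c / (c - β) * Real.exp (-(β * x))) := by
        rw [lintegral_const_mul _ (by fun_prop), lintegral_exp_mul_expDensity hc hβc, mul_comm,
          ENNReal.ofReal_mul (div_pos hc (sub_pos.2 hβc)).le]

theorem exists_rate_expDA_apply_compl_singleton_le (hk1 : k ≠ 1) :
    ∃ β ∈ Set.Ioc (0 : ℝ) (1 / 2), ∀ t, 0 ≤ t → ∀ x ∈ Set.Ioi t,
      expDA k hk x {x}ᶜ ≤ ENNReal.ofReal (2 * Real.exp (-(β * t))) := by
  set β := min |1 - k| (1 / 2)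
  have hβ0 : 0 < β := lt_min (abs_pos.2 (sub_ne_zero.2 hk1.symm)) one_half_pos
  have hβ_half : β ≤ 1 / 2 := min_le_right _ _
  refine ⟨β, ⟨hβ0, hβ_half⟩, fun t ht x hx => ?_⟩
  calc expDA k hk x {x}ᶜ ≤ ENNReal.ofReal (1 / (1 - β) * Real.exp (-(β * x))) :=
        (parKernel_apply_compl_singleton_le _ _ x).trans
          (lintegral_acceptedDensity_expDensity_le hk one_pos hβ0.le (min_le_left _ _)
            (by linarith) (ht.trans_lt hx))
    _ ≤ ENNReal.ofReal (2 * Real.exp (-(β * t))) := by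
        have hconst : 1 / (1 - β) ≤ 2 := by
          rw [div_le_iff₀ (by linarith)]
          linarith
        have hx' : t ≤ x := le_of_lt hx
        gcongr

theorem tendsto_ofReal_two_mul_exp_neg_mul {β : ℝ} (hβ : 0 < β) :
    Tendsto (fun t : ℝ => ENNReal.ofReal (2 * Real.exp (-(β * t)))) atTop (nhds 0) := by
  have hexp : Tendsto (fun t : ℝ => Real.exp (-(β * t))) atTop (nhds 0) :=
    Real.tendsto_exp_neg_atTop_nhds_zero.comp (tendsto_id.const_mul_atTop hβ)
  simpa using ENNReal.tendsto_ofReal (hexp.const_mul 2)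

theorem conductance_expDA (hk1 : k ≠ 1) : conductance (expDA k hk) expLaw = 0 := by
  obtain ⟨β, ⟨hβ, -⟩, hescape⟩ := exists_rate_expDA_apply_compl_singleton_le hk hk1
  refine le_antisymm (ge_of_tendsto (tendsto_ofReal_two_mul_exp_neg_mul hβ) ?_) zero_le
  filter_upwards [eventually_ge_atTop (Real.log 2)] with t ht
  have ht0 : 0 ≤ t := (Real.log_nonneg one_le_two).trans ht
  have hmass : expLaw (Set.Ioi t) = ENNReal.ofReal (Real.exp (-t)) := by
    simpa using expDensity_measure_Ioi one_pos ht0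
  refine conductance_le_of_forall_mem measurableSet_Ioi ?_ ?_ fun x hx =>
    (measure_mono (Set.compl_subset_compl.2 (Set.singleton_subset_iff.2 hx))).trans
      (hescape t ht0 x hx)
  · rw [hmass, ENNReal.ofReal_pos]
    exact Real.exp_pos _
  · rw [hmass, ← ENNReal.ofReal_ofNat 2, ← ENNReal.ofReal_one, ← ENNReal.ofReal_div_of_pos two_pos]
    refine ENNReal.ofReal_le_ofReal ?_
    calc Real.exp (-t) ≤ Real.exp (-Real.log 2) := Real.exp_le_exp.2 (neg_le_neg ht)
      _ = 1 / 2 := by rw [Real.exp_neg, Real.exp_log two_pos, one_div]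

theorem not_geometricallyErgodic_expDA (hk1 : k ≠ 1) :
    ¬ GeometricallyErgodic (expDA k hk) expLaw := by
  intro hge
  obtain ⟨ε, hε, hle⟩ := hge.exists_pos_le_apply_compl_singleton
  obtain ⟨β, ⟨hβ, -⟩, hescape⟩ := exists_rate_expDA_apply_compl_singleton_le hk hk1
  obtain ⟨t, ht, hlt⟩ := ((eventually_ge_atTop 0).and
    ((tendsto_ofReal_two_mul_exp_neg_mul hβ).eventually_lt_const hε)).exists
  have hnull : expLaw (Set.Ioi t) = 0 :=
    measure_mono_null (fun x hx => not_le.2 ((hescape t ht x hx).trans_lt hlt)) hle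
  rw [expDensity_measure_Ioi one_pos ht, ENNReal.ofReal_eq_zero] at hnull
  exact hnull.not_gt (Real.exp_pos _)

theorem not_varianceBounding_expDA (hk1 : k ≠ 1) : ¬ VarianceBounding (expDA k hk) expLaw := by
  obtain ⟨β, ⟨hβ, hβ_half⟩, hescape⟩ := exists_rate_expDA_apply_compl_singleton_le hk hk1
  have hγ : 2 * (1 / 2 - β / 4) < 1 := by linarith
  intro hvb
  exact (hvb _ (memLp_exp_mul_expDensity one_pos hγ)).ne
    (asymptoticVariance_exp_mul_eq_top one_pos (expDA_isReversible hk).invariant hβ hescape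
      (by linarith) hγ (by linarith))

end ExponentialDelayedAcceptance

end DelayedAcceptance

theorem mainTheorem12 (k : ℝ) (hk : 0 < k) (hk1 : k ≠ 1) :
    DelayedAcceptance.expMH.IsReversible DelayedAcceptance.expLaw ∧
      (DelayedAcceptance.expDA k hk).IsReversible DelayedAcceptance.expLaw ∧
      DelayedAcceptance.GeometricallyErgodic DelayedAcceptance.expMH DelayedAcceptance.expLaw ∧
      DelayedAcceptance.conductance (DelayedAcceptance.expDA k hk) DelayedAcceptance.expLaw = 0 ∧
      ¬ DelayedAcceptance.GeometricallyErgodic (DelayedAcceptance.expDA k hk)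
        DelayedAcceptance.expLaw ∧
      ¬ DelayedAcceptance.VarianceBounding (DelayedAcceptance.expDA k hk)
        DelayedAcceptance.expLaw :=
  ⟨DelayedAcceptance.mhKernel_isReversible _ _,
    DelayedAcceptance.expDA_isReversible hk,
    DelayedAcceptance.geometricallyErgodic_expMH,
    DelayedAcceptance.conductance_expDA hk hk1,
    DelayedAcceptance.not_geometricallyErgodic_expDA hk hk1,
    DelayedAcceptance.not_varianceBounding_expDA hk hk1⟩
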